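/- Fix an integer $d\ge 1$, a constant $C$ and a fixed cost $\sigma$ for evaluating a score. Computations are unit-cost computation trees on the input data: every arithmetic or memory step and every comparison costs one step. Let $R$ be a data structure for half-space range queries on $n$ points $L_1,\dots,L_n$ of $\mathbb R^d$: after preprocessing, it determines for any $w\in\mathbb R^d$, $b\in\mathbb R$ the set $B=\{i : \langle w,L_i\rangle\le b\}$. The set is identified, not written out, and is stored with its size and its five sums $S_{XX},S_{XY},S_{YY},S_X,S_Y$. Given a lift $\mathcal L:\mathbb R^2\to\mathbb R^d$, a real-valued score of a $k$-subset that depends on its five sums, and data $D=((X_i,Y_i))_{i=1}^n$, the *quadratic sweep* with $R$ computes $L_i=\mathcal L(X_i,Y_i)$ and preprocesses these points. Then, for every $d$-subset $P\subseteq\{1,\dots,n\}$, it takes a hyperplane through $\{L_i\}_{i\in P}$ (a nonzero kernel vector of $[L_P,\mathbf 1]$, charged $d^3$ steps) and makes one range query on each of its two sides. For each answer $B$ and each $P'\subseteq P$ with $|P'\cup(B\setminus P)|=k$, it scores the candidate $P'\cup(B\setminus P)$. It returns the best candidate found. **Theorem.** There are $c_1,c_2>0$ and $N$, depending only on $d,\sigma,C$,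 such that the following holds for all $n\ge N$ and $1\le k\le n$, every lift, every score, every data set of size $n$, and every such $R$ that answers all queries correctly with preprocessing time at most $C\,(n^{\lceil d/2\rceil}k^{\lfloor d/2\rfloor}+n\log n)$ and query time at most $C\log n$. The quadratic sweep makes at most $c_2 n^d$ range queries and runs in time at most $c_2\,n^d\log n$. If moreover the lifted points are in general position (no $d+1$ of them on a common hyperplane), it runs in time at least $c_1\,n^d\log n$; so on such data the running time is $\Theta(n^d\log n)$. -/

import Mathlib

/-- Unit-cost computations on an input of type `I` with a discrete result in `A`, as computation
trees.  `op` is one unbranched unit-cost step (an arithmetic operation, a memory access); the number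
it produces is a function of the input and need not be recorded, because tests may be arbitrary
functions of the input.  `branch` is one comparison: a yes/no test that decides how to go on. -/
inductive Comp (I : Type) (A : Type) : Type where
  | done (a : A) : Comp I A
  | op (next : Comp I A) : Comp I A
  | branch (test : I → Bool) (no yes : Comp I A) : Comp I A

namespace Comp

variable {I J A B : Type}

/-- The result of a computation on the input `x`. -/
def eval : Comp I A → I → A
  | done a, _ => a
  | op c, x => c.eval x
  | branch t c₀ c₁, x => if t x then c₁.eval x else c₀.eval x

/-- The running time of a computation on the input `x`: the number of steps that are executed. -/
def time : Comp I A → I → ℕ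
  | done _, _ => 0
  | op c, x => c.time x + 1
  | branch t c₀ c₁, x => (if t x then c₁.time x else c₀.time x) + 1

/-- Sequential composition. -/
def bind : Comp I A → (A → Comp I B) → Comp I B
  | done a, f => f a
  | op c, f => op (c.bind f)
  | branch t c₀ c₁, f => branch t (c₀.bind f) (c₁.bind f)

instance : Monad (Comp I) where
  pure := done
  bind := bind

/-- Run a computation on an input that is itself a function of the present input. -/
def comap (g : J → I) : Comp I A → Comp J A
  | done a => done a
  | op c => op (c.comap g)
  | branch t c₀ c₁ => branch (fun y => t (g y)) (c₀.comap g) (c₁.comap g)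

/-- `m` unbranched steps. -/
def ops : ℕ → Comp I Unit
  | 0 => done ()
  | m + 1 => op (ops m)

/-- One comparison, returning its outcome. -/
def ask (test : I → Bool) : Comp I Bool := branch test (done false) (done true)

end Comp

/-- The indices of the points in the closed half-space `{x | ⟨w, x⟩ ≤ b}`. -/
noncomputable def halfspaceRange {d n : ℕ} (L : Fin n → Fin d → ℝ) (w : Fin d → ℝ) (b : ℝ) :
    Finset (Fin n) :=
  open Classical in Finset.univ.filter fun i => w ⬝ᵥ L i ≤ b

/-- A data structure for half-space range queries on `n` points of `ℝ^d`.  The outer computation is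
the preprocessing of the points; its result is the procedure that is run, on the points and a
half-space `(w, b)`, to answer a query.  The answer identifies the set of points in the half-space
(which is not written out element by element). -/
abbrev RangeStructure (d n : ℕ) : Type :=
  Comp (Fin n → Fin d → ℝ)
    (Comp ((Fin n → Fin d → ℝ) × (Fin d → ℝ) × ℝ) (Finset (Fin n)))

/-- Every half-space query on every point set is answered correctly. -/
def RangeStructure.Correct {d n : ℕ} (R : RangeStructure d n) : Prop :=
  ∀ (L : Fin n → Fin d → ℝ) (w : Fin d → ℝ) (b : ℝ),
    (R.eval L).eval (L, w, b) = halfspaceRange L w b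

/-- Preprocessing takes at most `p` steps on every point set. -/
def RangeStructure.PreprocessingTimeLE {d n : ℕ} (R : RangeStructure d n) (p : ℝ) : Prop :=
  ∀ L : Fin n → Fin d → ℝ, (R.time L : ℝ) ≤ p

/-- Every half-space query on every point set takes at most `q` steps. -/
def RangeStructure.QueryTimeLE {d n : ℕ} (R : RangeStructure d n) (q : ℝ) : Prop :=
  ∀ (L : Fin n → Fin d → ℝ) (w : Fin d → ℝ) (b : ℝ),
    ((R.eval L).time (L, w, b) : ℝ) ≤ q

/-- No `d + 1` of the points lie on a common hyperplane. -/
def InGeneralPosition {d n : ℕ} (L : Fin n → Fin d → ℝ) : Prop :=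
  ∀ f : Fin (d + 1) ↪ Fin n, AffineIndependent ℝ fun j => L (f j)

/-- Normal vector and offset `(w, b)` of a hyperplane `⟨w, x⟩ = b` through the points indexed by
`P`: a nonzero vector `(w, -b)` of the kernel of the matrix `[L_P, 1]`.  For `|P| = d` one always
exists, `d` homogeneous equations having a nonzero solution in `d + 1` unknowns. -/
noncomputable def hyperplaneThrough {d n : ℕ} (L : Fin n → Fin d → ℝ) (P : Finset (Fin n)) :
    (Fin d → ℝ) × ℝ :=
  Classical.epsilon fun h => h ≠ 0 ∧ ∀ i ∈ P, h.1 ⬝ᵥ L i = h.2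

/-- The sums `(S_XX, S_XY, S_YY, S_X, S_Y)` of the data points with index in `S`. -/
def sums {n : ℕ} (D : Fin n → ℝ × ℝ) (S : Finset (Fin n)) : Fin 5 → ℝ :=
  ![∑ i ∈ S, (D i).1 ^ 2, ∑ i ∈ S, (D i).1 * (D i).2, ∑ i ∈ S, (D i).2 ^ 2,
    ∑ i ∈ S, (D i).1, ∑ i ∈ S, (D i).2]

/-- State of the sweep: the best `k`-subset so far (`none` before the first one) and the number of
range queries made. -/
structure SweepState (n : ℕ) where
  best : Option (Finset (Fin n))
  queries : ℕ

namespace QuadraticSweep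

variable {d n : ℕ}

/-- Score the candidate `S` and keep it if it beats the best one so far.  `cost` pays for obtaining
the five sums of `S` and evaluating the score on them; the comparison is one further step. -/
noncomputable def consider (score : (Fin 5 → ℝ) → ℝ) (cost : ℕ) (S : Finset (Fin n))
    (st : SweepState n) : Comp (Fin n → ℝ × ℝ) (SweepState n) := do
  Comp.ops cost
  match st.best with
  | none => return { st with best := some S }
  | some S₀ =>
    let better ← Comp.ask fun D =>
      open Classical in decide (score (sums D S₀) < score (sums D S))
    if better then return { st with best := some S } else return st

/-- One range query, with the half-space on the side `s = 1` or `s = -1` of the hyperplane through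
the lifted points of `P`, and the candidates `P' ∪ (B \ P)` of size `k` that it yields, `P' ⊆ P`.
A range `B` is stored with its size and its five sums, so one step tests the size of a candidate,
and `5 * (d + |P'|)` additions and subtractions give its sums. -/
noncomputable def side (lift : ℝ × ℝ → Fin d → ℝ) (score : (Fin 5 → ℝ) → ℝ) (scoreCost k : ℕ)
    (Q : Comp ((Fin n → Fin d → ℝ) × (Fin d → ℝ) × ℝ) (Finset (Fin n)))
    (P : Finset (Fin n)) (st : SweepState n) (s : ℝ) :
    Comp (Fin n → ℝ × ℝ) (SweepState n) := do
  let B ← Q.comap fun D =>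
    let L := fun i => lift (D i)
    let h := hyperplaneThrough L P
    (L, s • h.1, s * h.2)
  P.powerset.toList.foldlM
    (fun st P' => do
      Comp.ops 1
      let S := P' ∪ (B \ P)
      if S.card = k then consider score (5 * (d + P'.card) + scoreCost) S st else return st)
    { st with queries := st.queries + 1 }

/-- One iteration of the outer loop: `d ^ 3` steps for the hyperplane through the `d`-subset `P`,
then a query on either side of it. -/
noncomputable def iteration (lift : ℝ × ℝ → Fin d → ℝ) (score : (Fin 5 → ℝ) → ℝ)
    (scoreCost k : ℕ) (Q : Comp ((Fin n → Fin d → ℝ) × (Fin d → ℝ) × ℝ) (Finset (Fin n)))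
    (st : SweepState n) (P : Finset (Fin n)) : Comp (Fin n → ℝ × ℝ) (SweepState n) := do
  Comp.ops (d ^ 3)
  [1, -1].foldlM (side lift score scoreCost k Q P) st

end QuadraticSweep

/-- The quadratic sweep with the range structure `R`: lift the `n` data points to `ℝ^d` and compute
the five terms of each that enter the sums, preprocess the lifted points, run over all `d`-subsets
`P`, and finally write out the best `k`-subset found. -/
noncomputable def quadraticSweep {d n : ℕ} (R : RangeStructure d n) (lift : ℝ × ℝ → Fin d → ℝ)
    (score : (Fin 5 → ℝ) → ℝ) (scoreCost k : ℕ) :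
    Comp (Fin n → ℝ × ℝ) (SweepState n) := do
  Comp.ops (n * d + 5 * n)
  let Q ← Comp.comap (fun D i => lift (D i)) R
  let st ← (Finset.univ.powersetCard d).toList.foldlM
    (QuadraticSweep.iteration lift score scoreCost k Q) ⟨none, 0⟩
  Comp.ops n
  return st

/-! Upper bound: there are `n.choose d ≤ n ^ d` iterations, each with two queries of `O(log n)`
steps and at most `2 ^ d` candidates per query at constant cost. Preprocessing is absorbed because
`⌈d/2⌉ + ⌊d/2⌋ = d` and `k ≤ n`.

Lower bound: an information-theoretic count. Once the points are fixed, the query procedure is one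
binary tree, so it has at most `2 ^ t` answers reachable within time `t`
(`Comp.exists_card_le_of_time_le`), however powerful its tests. In general position the two answers
for `P` intersect exactly in `P` (`halfspaceRange_inter_halfspaceRange`), so pairs of answers
separate the `d`-subsets and at most `4 ^ t` of them have both queries fast (`card_fast_le`). With
`4 ^ t` about half of `M = n.choose d`, at least half of the subsets cost more than `t`, in total
`Ω(M log M)`, and `M` is of order `n ^ d`. -/

/-! ### Cost calculus and leaf counting for computation trees. -/

namespace Comp

variable {I J A B : Type}

@[simp] theorem eval_pure (a : A) (x : I) : (pure a : Comp I A).eval x = a := rfl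

@[simp] theorem time_pure (a : A) (x : I) : (pure a : Comp I A).time x = 0 := rfl

@[simp] theorem eval_bind (c : Comp I A) (f : A → Comp I B) (x : I) :
    (c >>= f).eval x = (f (c.eval x)).eval x := by
  change (c.bind f).eval x = _
  induction c with
  | done a => rfl
  | op c ih => simpa [bind, eval] using ih
  | branch t c₀ c₁ ih₀ ih₁ =>
    by_cases h : t x <;> simp [bind, eval, h, ih₀, ih₁]

@[simp] theorem time_bind (c : Comp I A) (f : A → Comp I B) (x : I) :
    (c >>= f).time x = c.time x + (f (c.eval x)).time x := by
  change (c.bind f).time x = _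
  induction c with
  | done a => simp [bind, eval, time]
  | op c ih => simp only [bind, eval, time, ih]; omega
  | branch t c₀ c₁ ih₀ ih₁ =>
    by_cases h : t x <;> simp only [bind, eval, time, h, ih₀, ih₁] <;> simp <;> omega

@[simp] theorem eval_comap (g : J → I) (c : Comp I A) (y : J) :
    (c.comap g).eval y = c.eval (g y) := by
  induction c with
  | done a => rfl
  | op c ih => simpa [comap, eval] using ih
  | branch t c₀ c₁ ih₀ ih₁ => simp [comap, eval, ih₀, ih₁]

@[simp] theorem time_comap (g : J → I) (c : Comp I A) (y : J) :
    (c.comap g).time y = c.time (g y) := by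
  induction c with
  | done a => rfl
  | op c ih => simpa [comap, time] using ih
  | branch t c₀ c₁ ih₀ ih₁ => simp [comap, time, ih₀, ih₁]

@[simp] theorem time_ops (m : ℕ) (x : I) : (ops m).time x = m := by
  induction m with
  | zero => rfl
  | succ m ih => simp [ops, time, ih]

@[simp] theorem time_ask (t : I → Bool) (x : I) : (ask t).time x = 1 := by
  simp [ask, time]

theorem time_foldlM_le {f : B → A → Comp I B} {l : List A} {x : I} {T : ℝ}
    (h : ∀ s, ∀ a ∈ l, ((f s a).time x : ℝ) ≤ T) (s : B) :
    ((l.foldlM f s).time x : ℝ) ≤ l.length * T := by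
  induction l generalizing s with
  | nil => simp
  | cons a l ih =>
    have h₁ := h s a (by simp)
    have h₂ := ih (fun s b hb => h s b (by simp [hb])) ((f s a).eval x)
    simp only [List.foldlM_cons, time_bind, List.length_cons]
    push_cast
    linarith

theorem sum_le_time_foldlM {f : B → A → Comp I B} {l : List A} {x : I} {g : A → ℕ}
    (h : ∀ s, ∀ a ∈ l, g a ≤ (f s a).time x) (s : B) :
    (l.map g).sum ≤ (l.foldlM f s).time x := by
  induction l generalizing s with
  | nil => simp
  | cons a l ih =>
    have h₁ := h s a (by simp)
    have h₂ := ih (fun s b hb => h s b (by simp [hb])) ((f s a).eval x)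
    simp only [List.foldlM_cons, time_bind, List.map_cons, List.sum_cons]
    omega

/-- Serves to count queries at three levels: `m = 0` for candidates, `1` for sides, `2` for
iterations. -/
theorem eval_foldlM_add {f : B → A → Comp I B} {x : I} {m : ℕ} (q : B → ℕ)
    (h : ∀ s a, q ((f s a).eval x) = q s + m) (l : List A) (s : B) :
    q ((l.foldlM f s).eval x) = q s + l.length * m := by
  induction l generalizing s with
  | nil => simp
  | cons a l ih =>
    simp only [List.foldlM_cons, eval_bind, List.length_cons, ih, h]
    ring

/-- A computation has at most `2 ^ t` different results that it reaches within time `t`. -/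
theorem exists_card_le_of_time_le (c : Comp I A) (t : ℕ) :
    ∃ F : Finset A, F.card ≤ 2 ^ t ∧ ∀ x, c.time x ≤ t → c.eval x ∈ F := by
  classical
  induction c generalizing t with
  | done a => exact ⟨{a}, by simpa using Nat.one_le_two_pow, by simp [eval]⟩
  | op c ih =>
    obtain ⟨F, hF, h⟩ := ih t
    exact ⟨F, hF, fun x hx => h x (by simp only [time] at hx; omega)⟩
  | branch test c₀ c₁ ih₀ ih₁ =>
    cases t with
    | zero => exact ⟨∅, by simp, fun x hx => by simp [time] at hx⟩
    | succ t =>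
      obtain ⟨F₀, hF₀, h₀⟩ := ih₀ t
      obtain ⟨F₁, hF₁, h₁⟩ := ih₁ t
      -- The comparison uses one step, so each subtree keeps budget `t` and the bounds add to `2 ^ t
      -- + 2 ^ t`.
      refine ⟨F₀ ∪ F₁, (Finset.card_union_le _ _).trans (by rw [pow_succ]; omega), fun x hx => ?_⟩
      simp only [time] at hx
      by_cases hb : test x
      · simp only [hb, if_true] at hx
        simp [eval, hb, h₁ x (by omega)]
      · simp only [hb] at hx
        simp [eval, hb, h₀ x (by simpa using hx)]

end Comp

/-! ### Hyperplanes through `d` points and the lower bound on query time. -/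

section Geometry

variable {d n : ℕ}

theorem hyperplaneThrough_spec (L : Fin n → Fin d → ℝ) {P : Finset (Fin n)} (hP : P.card = d) :
    hyperplaneThrough L P ≠ 0 ∧
      ∀ i ∈ P, (hyperplaneThrough L P).1 ⬝ᵥ L i = (hyperplaneThrough L P).2 := by
  refine Classical.epsilon_spec
    (p := fun h : (Fin d → ℝ) × ℝ => h ≠ 0 ∧ ∀ i ∈ P, h.1 ⬝ᵥ L i = h.2) ?_
  let φ : ((Fin d → ℝ) × ℝ) →ₗ[ℝ] (P → ℝ) :=
    { toFun := fun h i => h.1 ⬝ᵥ L i - h.2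
      map_add' := fun a b => by
        ext i
        simp only [Prod.fst_add, Prod.snd_add, add_dotProduct, Pi.add_apply]
        ring
      map_smul' := fun r a => by
        ext i
        simp only [Prod.smul_fst, Prod.smul_snd, smul_dotProduct, Pi.smul_apply, smul_eq_mul,
          RingHom.id_apply]
        ring }
  have hφ : LinearMap.ker φ ≠ ⊥ := LinearMap.ker_ne_bot_of_finrank_lt (by simp [hP])
  obtain ⟨h, hh, h0⟩ := (Submodule.ne_bot_iff _).1 hφ
  refine ⟨h, h0, fun i hi => ?_⟩
  have := congrFun (LinearMap.mem_ker.1 hh) ⟨i, hi⟩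
  exact sub_eq_zero.1 this

/-- The differences `p i - p j` span the whole space and `w` is orthogonal to all of them, hence to
itself. -/
theorem normal_eq_zero_of_affineIndependent {p : Fin (d + 1) → Fin d → ℝ}
    (hp : AffineIndependent ℝ p) {w : Fin d → ℝ} {b : ℝ} (h : ∀ j, w ⬝ᵥ p j = b) : w = 0 := by
  have hspan : vectorSpan ℝ (Set.range p) = ⊤ :=
    hp.vectorSpan_eq_top_of_card_eq_finrank_add_one (by simp)
  let φ : (Fin d → ℝ) →ₗ[ℝ] ℝ :=
    { toFun := fun x => w ⬝ᵥ x
      map_add' := fun x y => dotProduct_add w x y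
      map_smul' := fun r x => dotProduct_smul r w x }
  have hle : vectorSpan ℝ (Set.range p) ≤ LinearMap.ker φ := by
    rw [vectorSpan, Submodule.span_le]
    rintro _ ⟨_, ⟨i, rfl⟩, _, ⟨j, rfl⟩, rfl⟩
    change w ⬝ᵥ (p i - p j) = 0
    rw [dotProduct_sub, h, h, sub_self]
  refine dotProduct_self_eq_zero.1 ?_
  exact LinearMap.mem_ker.1 (hle (hspan ▸ Submodule.mem_top : w ∈ _))

/-- In general position the hyperplane through `d` of the points contains no further point. -/
theorem mem_iff_on_hyperplaneThrough {L : Fin n → Fin d → ℝ}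
    (hL : InGeneralPosition L) {P : Finset (Fin n)} (hP : P.card = d) (i : Fin n) :
    (hyperplaneThrough L P).1 ⬝ᵥ L i = (hyperplaneThrough L P).2 ↔ i ∈ P := by
  obtain ⟨h0, hon⟩ := hyperplaneThrough_spec L hP
  refine ⟨fun hi => ?_, hon i⟩
  by_contra hiP
  have hcard : (insert i P).card = d + 1 := by rw [Finset.card_insert_of_notMem hiP, hP]
  let f : Fin (d + 1) ↪ Fin n := ((insert i P).orderEmbOfFin hcard).toEmbedding
  have hw : (hyperplaneThrough L P).1 = 0 := by
    refine normal_eq_zero_of_affineIndependent (hL f) (b := (hyperplaneThrough L P).2) fun j => ?_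
    rcases Finset.mem_insert.1 ((insert i P).orderEmbOfFin_mem hcard j) with hj | hj
    · change _ ⬝ᵥ L ((insert i P).orderEmbOfFin hcard j) = _
      rw [hj, hi]
    · exact hon _ hj
  have hb : (hyperplaneThrough L P).2 = 0 := by rw [← hi, hw, zero_dotProduct]
  exact h0 (Prod.ext hw hb)

/-- In general position the ranges on the two sides of the hyperplane through `P` meet in `P`. -/
theorem halfspaceRange_inter_halfspaceRange {L : Fin n → Fin d → ℝ}
    (hL : InGeneralPosition L) {P : Finset (Fin n)} (hP : P.card = d) :
    halfspaceRange L ((1 : ℝ) • (hyperplaneThrough L P).1) (1 * (hyperplaneThrough L P).2) ∩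
      halfspaceRange L ((-1 : ℝ) • (hyperplaneThrough L P).1)
        (-1 * (hyperplaneThrough L P).2) = P := by
  ext i
  rw [← mem_iff_on_hyperplaneThrough hL hP i]
  simp only [halfspaceRange, Finset.mem_inter, Finset.mem_filter, Finset.mem_univ, true_and,
    one_smul, one_mul, neg_smul, neg_mul, neg_dotProduct, neg_le_neg_iff]
  exact ⟨fun h => le_antisymm h.1 h.2, fun h => ⟨h.le, h.ge⟩⟩

/-- The time of the query made for `P` on the side `s`. -/
noncomputable def sideQueryTime
    (Q : Comp ((Fin n → Fin d → ℝ) × (Fin d → ℝ) × ℝ) (Finset (Fin n)))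
    (L : Fin n → Fin d → ℝ) (P : Finset (Fin n)) (s : ℝ) : ℕ :=
  Q.time (L, s • (hyperplaneThrough L P).1, s * (hyperplaneThrough L P).2)

/-- In general position at most `4 ^ t` of the `d`-subsets have both queries answered within
time `t`. -/
theorem card_fast_le {L : Fin n → Fin d → ℝ} (hL : InGeneralPosition L)
    {Q : Comp ((Fin n → Fin d → ℝ) × (Fin d → ℝ) × ℝ) (Finset (Fin n))}
    (hQ : ∀ w b, Q.eval (L, w, b) = halfspaceRange L w b) (t : ℕ) :
    ((Finset.univ.powersetCard d).filter fun P : Finset (Fin n) =>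
      sideQueryTime Q L P 1 ≤ t ∧ sideQueryTime Q L P (-1) ≤ t).card ≤ 4 ^ t := by
  obtain ⟨F, hF, hmem⟩ := Q.exists_card_le_of_time_le t
  calc _ ≤ (F ×ˢ F).card := by
        refine Finset.card_le_card_of_injOn
          (fun P => (halfspaceRange L ((1 : ℝ) • (hyperplaneThrough L P).1)
              (1 * (hyperplaneThrough L P).2),
            halfspaceRange L ((-1 : ℝ) • (hyperplaneThrough L P).1)
              (-1 * (hyperplaneThrough L P).2))) ?_ ?_
        · intro P hP
          obtain ⟨-, h₁, h₂⟩ := Finset.mem_filter.1 hP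
          simp only [Finset.coe_product, Set.mem_prod, Finset.mem_coe]
          exact ⟨hQ _ _ ▸ hmem _ h₁, hQ _ _ ▸ hmem _ h₂⟩
        -- Injectivity: `P` is recovered as the intersection of its two ranges.
        · intro P hP P' hP' heq
          have hc := (Finset.mem_powersetCard.1 (Finset.mem_filter.1 hP).1).2
          have hc' := (Finset.mem_powersetCard.1 (Finset.mem_filter.1 hP').1).2
          rw [← halfspaceRange_inter_halfspaceRange hL hc,
            ← halfspaceRange_inter_halfspaceRange hL hc']
          exact congrArg (fun B => B.1 ∩ B.2) heq
    _ ≤ 2 ^ t * 2 ^ t := by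
        rw [Finset.card_product]
        exact Nat.mul_le_mul hF hF
    _ = 4 ^ t := by rw [← mul_pow]; norm_num

/-- In general position the queries for all `d`-subsets take `Ω(M log M)` steps in total, where `M`
is the number of these subsets. -/
theorem half_choose_mul_log_le_sum_sideQueryTime {L : Fin n → Fin d → ℝ}
    (hL : InGeneralPosition L)
    {Q : Comp ((Fin n → Fin d → ℝ) × (Fin d → ℝ) × ℝ) (Finset (Fin n))}
    (hQ : ∀ w b, Q.eval (L, w, b) = halfspaceRange L w b) (hM : 2 ≤ n.choose d) :
    (n.choose d / 2 : ℝ) * (Real.log (n.choose d / 2) / Real.log 4) ≤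
      ((∑ P ∈ Finset.univ.powersetCard d,
        (sideQueryTime Q L P 1 + sideQueryTime Q L P (-1)) : ℕ) : ℝ) := by
  set M := n.choose d with hMdef
  -- The largest `t` for which the bound `4 ^ t` on fast subsets is at most half of `M`; `2 ≤ M`
  -- keeps `M / 2` nonzero.
  set t := Nat.log 4 (M / 2) with ht
  have hfast : 4 ^ t ≤ M / 2 := Nat.pow_log_le_self 4 (by omega)
  have hlt : M / 2 < 4 ^ (t + 1) := Nat.lt_pow_succ_log_self (by norm_num) _
  have hcard := Finset.card_filter_add_card_filter_not
    (s := (Finset.univ : Finset (Fin n)).powersetCard d)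
    (fun P => sideQueryTime Q L P 1 ≤ t ∧ sideQueryTime Q L P (-1) ≤ t)
  rw [Finset.card_powersetCard, Finset.card_univ, Fintype.card_fin, ← hMdef] at hcard
  have hslow := card_fast_le hL hQ t
  set S := (Finset.univ.powersetCard d).filter fun P : Finset (Fin n) =>
    ¬(sideQueryTime Q L P 1 ≤ t ∧ sideQueryTime Q L P (-1) ≤ t) with hS
  have hSM : M ≤ 2 * S.card := by omega
  have hsum : S.card * (t + 1) ≤ ∑ P ∈ Finset.univ.powersetCard d,
      (sideQueryTime Q L P 1 + sideQueryTime Q L P (-1)) := by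
    calc S.card * (t + 1) = ∑ P ∈ S, (t + 1) := by simp
      _ ≤ ∑ P ∈ S, (sideQueryTime Q L P 1 + sideQueryTime Q L P (-1)) := by
        -- For a slow `P` at least one of its two queries exceeds `t`.
        refine Finset.sum_le_sum fun P hP => ?_
        have := (Finset.mem_filter.1 hP).2
        omega
      _ ≤ _ := Finset.sum_le_sum_of_subset (Finset.filter_subset _ _)
  have hSM' : (M : ℝ) / 2 ≤ S.card := by
    have : (M : ℝ) ≤ 2 * S.card := by exact_mod_cast hSM
    linarith
  have hM' : (2 : ℝ) ≤ M := by exact_mod_cast hM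
  have hlog : Real.log (M / 2) / Real.log 4 ≤ t + 1 := by
    have h4 : (M : ℝ) / 2 ≤ 4 ^ (t + 1) := by
      have : M ≤ 2 * 4 ^ (t + 1) := by omega
      have : (M : ℝ) ≤ 2 * 4 ^ (t + 1) := by exact_mod_cast this
      linarith
    rw [div_le_iff₀ (Real.log_pos (by norm_num))]
    calc Real.log (M / 2) ≤ Real.log (4 ^ (t + 1)) := Real.log_le_log (by linarith) h4
      _ = (t + 1) * Real.log 4 := by rw [Real.log_pow]; push_cast; ring
  calc (M / 2 : ℝ) * (Real.log (M / 2) / Real.log 4) ≤ S.card * (t + 1) :=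
        mul_le_mul hSM' hlog
          (div_nonneg (Real.log_nonneg (by linarith)) (Real.log_nonneg (by norm_num)))
          (by positivity)
    _ ≤ _ := by exact_mod_cast hsum

end Geometry

/-! ### Cost of one iteration. -/

namespace QuadraticSweep

variable {d n : ℕ} (lift : ℝ × ℝ → Fin d → ℝ) (score : (Fin 5 → ℝ) → ℝ) (scoreCost k : ℕ)
  (Q : Comp ((Fin n → Fin d → ℝ) × (Fin d → ℝ) × ℝ) (Finset (Fin n)))
  (P : Finset (Fin n)) (st : SweepState n) (s : ℝ) (D : Fin n → ℝ × ℝ)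

theorem time_consider_le (cost : ℕ) (S : Finset (Fin n)) :
    (consider score cost S st).time D ≤ cost + 1 := by
  unfold consider
  rcases st with ⟨_ | S₀, q⟩
  · simp
  · simp only [Comp.time_bind, Comp.time_ops, Comp.time_ask]
    split_ifs <;> simp

theorem queries_consider (cost : ℕ) (S : Finset (Fin n)) :
    ((consider score cost S st).eval D).queries = st.queries := by
  unfold consider
  rcases st with ⟨_ | S₀, q⟩
  · simp
  · simp only [Comp.eval_bind]
    split_ifs <;> simp

theorem queries_side :
    ((side lift score scoreCost k Q P st s).eval D).queries = st.queries + 1 := by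
  unfold side
  simp only [Comp.eval_bind]
  rw [Comp.eval_foldlM_add (m := 0) SweepState.queries]
  · simp
  · intro st P'
    simp only [Comp.eval_bind]
    split_ifs
    · simp [queries_consider]
    · simp

theorem queries_iteration :
    ((iteration lift score scoreCost k Q st P).eval D).queries = st.queries + 2 := by
  unfold iteration
  rw [Comp.eval_bind, Comp.eval_foldlM_add (m := 1) SweepState.queries]
  · simp
  · intro st s
    exact queries_side lift score scoreCost k Q P st s D

theorem sideQueryTime_le_time_side :
    sideQueryTime Q (fun i => lift (D i)) P s ≤
      (side lift score scoreCost k Q P st s).time D := by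
  unfold side
  rw [Comp.time_bind, Comp.time_comap]
  exact Nat.le_add_right _ _

theorem sum_sideQueryTime_le_time_iteration :
    sideQueryTime Q (fun i => lift (D i)) P 1 + sideQueryTime Q (fun i => lift (D i)) P (-1) ≤
      (iteration lift score scoreCost k Q st P).time D := by
  unfold iteration
  rw [Comp.time_bind]
  refine le_add_left (le_trans ?_ (Comp.sum_le_time_foldlM
    (g := sideQueryTime Q (fun i => lift (D i)) P) (fun st s _ =>
      sideQueryTime_le_time_side lift score scoreCost k Q P st s D) st))
  simp

variable {P}

/-- Each of the `2 ^ d` subsets `P'` costs one size test, at most `5 * (d + d)` steps for the sums,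
the score, and one comparison. -/
theorem time_side_le (hP : P.card = d) :
    ((side lift score scoreCost k Q P st s).time D : ℝ) ≤
      sideQueryTime Q (fun i => lift (D i)) P s + 2 ^ d * (10 * d + scoreCost + 2) := by
  unfold side
  rw [Comp.time_bind, Comp.time_comap, Nat.cast_add]
  refine add_le_add le_rfl ((Comp.time_foldlM_le (T := 10 * d + scoreCost + 2) ?_ _).trans ?_)
  · intro st P' hP'
    have hle : P'.card ≤ d :=
      hP ▸ Finset.card_le_card (Finset.mem_powerset.1 (Finset.mem_toList.1 hP'))
    simp only [Comp.time_bind, Comp.time_ops]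
    split_ifs
    · have := time_consider_le score st D (5 * (d + P'.card) + scoreCost)
        (P' ∪ ((Q.comap fun D : Fin n → ℝ × ℝ => (fun i => lift (D i),
          s • (hyperplaneThrough (fun i => lift (D i)) P).1,
          s * (hyperplaneThrough (fun i => lift (D i)) P).2)).eval D \ P))
      have h : 1 + (consider score (5 * (d + P'.card) + scoreCost)
        (P' ∪ ((Q.comap fun D : Fin n → ℝ × ℝ => (fun i => lift (D i),
          s • (hyperplaneThrough (fun i => lift (D i)) P).1,
          s * (hyperplaneThrough (fun i => lift (D i)) P).2)).eval D \ P)) st).time D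
          ≤ 10 * d + scoreCost + 2 := by omega
      exact_mod_cast h
    · have h : 1 ≤ 10 * d + scoreCost + 2 := by omega
      rw [Comp.time_pure]
      exact_mod_cast h
  · rw [Finset.length_toList, Finset.card_powerset, hP]
    push_cast
    exact le_rfl

theorem time_iteration_le (hP : P.card = d) {q : ℝ}
    (hq : ∀ s, (sideQueryTime Q (fun i => lift (D i)) P s : ℝ) ≤ q) :
    ((iteration lift score scoreCost k Q st P).time D : ℝ) ≤
      d ^ 3 + 2 * (q + 2 ^ d * (10 * d + scoreCost + 2)) := by
  unfold iteration
  rw [Comp.time_bind, Comp.time_ops, Nat.cast_add, Nat.cast_pow]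
  refine add_le_add le_rfl ((Comp.time_foldlM_le
    (T := q + 2 ^ d * (10 * d + scoreCost + 2)) (fun st s _ => ?_) st).trans (by simp))
  exact (time_side_le lift score scoreCost k Q st s D hP).trans (by gcongr; exact hq s)

end QuadraticSweep

/-! ### Query count and running time of the whole sweep. -/

section Sweep

variable {d n : ℕ} (R : RangeStructure d n) (lift : ℝ × ℝ → Fin d → ℝ)
  (score : (Fin 5 → ℝ) → ℝ) (scoreCost k : ℕ) (D : Fin n → ℝ × ℝ)

theorem queries_quadraticSweep :
    ((quadraticSweep R lift score scoreCost k).eval D).queries = 2 * n.choose d := by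
  unfold quadraticSweep
  simp only [Comp.eval_bind, Comp.eval_pure]
  rw [Comp.eval_foldlM_add (m := 2) SweepState.queries]
  · simp [mul_comm]
  · intro st P
    exact QuadraticSweep.queries_iteration lift score scoreCost k _ P st D

theorem time_quadraticSweep_le {q : ℝ} (hq : R.QueryTimeLE q) :
    ((quadraticSweep R lift score scoreCost k).time D : ℝ) ≤
      n * (d + 6) + R.time (fun i => lift (D i)) +
        n.choose d * (d ^ 3 + 2 * (q + 2 ^ d * (10 * d + scoreCost + 2))) := by
  unfold quadraticSweep
  simp only [Comp.time_bind, Comp.time_pure, Comp.time_ops, Comp.time_comap, Comp.eval_comap]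
  have h := Comp.time_foldlM_le (x := D)
    (f := QuadraticSweep.iteration lift score scoreCost k (R.eval fun i => lift (D i)))
    (l := (Finset.univ.powersetCard d).toList)
    (T := d ^ 3 + 2 * (q + 2 ^ d * (10 * d + scoreCost + 2)))
    (fun st P hP => QuadraticSweep.time_iteration_le lift score scoreCost k _ st D
      (Finset.mem_powersetCard.1 (Finset.mem_toList.1 hP)).2 fun s => hq _ _ _) ⟨none, 0⟩
  rw [Finset.length_toList, Finset.card_powersetCard, Finset.card_univ, Fintype.card_fin] at h
  push_cast
  linarith

theorem sum_sideQueryTime_le_time_quadraticSweep :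
    ∑ P ∈ Finset.univ.powersetCard d,
      (sideQueryTime (R.eval fun i => lift (D i)) (fun i => lift (D i)) P 1 +
        sideQueryTime (R.eval fun i => lift (D i)) (fun i => lift (D i)) P (-1)) ≤
      (quadraticSweep R lift score scoreCost k).time D := by
  unfold quadraticSweep
  simp only [Comp.time_bind, Comp.time_pure, Comp.time_ops, Comp.time_comap, Comp.eval_comap]
  rw [← Finset.sum_map_toList]
  have h := Comp.sum_le_time_foldlM (x := D)
    (f := QuadraticSweep.iteration lift score scoreCost k (R.eval fun i => lift (D i)))
    (l := (Finset.univ.powersetCard d).toList)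
    (g := fun P => sideQueryTime (R.eval fun i => lift (D i)) (fun i => lift (D i)) P 1 +
        sideQueryTime (R.eval fun i => lift (D i)) (fun i => lift (D i)) P (-1))
    (fun st P _ => QuadraticSweep.sum_sideQueryTime_le_time_iteration lift score scoreCost k _ P
      st D) ⟨none, 0⟩
  omega

end Sweep

/-! ### Asymptotic estimates and the choice of constants. -/

theorem mul_pow_le_choose {n d : ℕ} (h : 2 * d ≤ n) :
    (1 / (2 ^ d * d.factorial) : ℝ) * n ^ d ≤ n.choose d := by
  have h₁ : ((n + 1 - d : ℕ) ^ d : ℝ) ≤ d.factorial * n.choose d := by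
    have := Nat.pow_le_choose (α := ℝ) d n
    rw [div_le_iff₀ (by positivity)] at this
    linarith
  have h₂ : (n / 2 : ℝ) ≤ (n + 1 - d : ℕ) := by
    have : n ≤ 2 * (n + 1 - d) := by omega
    have : (n : ℝ) ≤ 2 * (n + 1 - d : ℕ) := by exact_mod_cast this
    linarith
  have h₃ : (n / 2 : ℝ) ^ d ≤ d.factorial * n.choose d := (by gcongr : _ ≤ _).trans h₁
  rw [div_pow, div_le_iff₀ (by positivity)] at h₃
  rw [one_div_mul_eq_div, div_le_iff₀ (by positivity)]
  linarith

theorem pow_mul_pow_add_mul_log_le {n k d : ℕ} (hd : 1 ≤ d) (hn : 1 ≤ n)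
    (hlog : 1 ≤ Real.log n) (hk : k ≤ n) :
    (n : ℝ) ^ ((d + 1) / 2) * (k : ℝ) ^ (d / 2) + n * Real.log n ≤
      2 * ((n : ℝ) ^ d * Real.log n) := by
  have hn' : (1 : ℝ) ≤ n := by exact_mod_cast hn
  have h₁ : (n : ℝ) ^ ((d + 1) / 2) * (k : ℝ) ^ (d / 2) ≤ n ^ d := by
    calc (n : ℝ) ^ ((d + 1) / 2) * (k : ℝ) ^ (d / 2) ≤ n ^ ((d + 1) / 2) * n ^ (d / 2) := by
          gcongr
      _ = n ^ d := by rw [← pow_add]; congr 1; omega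
  have h₂ : (n : ℝ) * Real.log n ≤ n ^ d * Real.log n := by
    gcongr
    exact le_self_pow₀ hn' (by omega)
  have h₃ : (n : ℝ) ^ d ≤ n ^ d * Real.log n := le_mul_of_one_le_right (by positivity) hlog
  linarith

theorem theorem2 (d : ℕ) (hd : 1 ≤ d) (scoreCost : ℕ) (C : ℝ) :
    ∃ c₁ c₂ : ℝ, 0 < c₁ ∧ 0 < c₂ ∧ ∃ N : ℕ, ∀ n : ℕ, N ≤ n → ∀ k : ℕ, 1 ≤ k → k ≤ n →
      ∀ R : RangeStructure d n, R.Correct →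
        R.PreprocessingTimeLE
          (C * ((n : ℝ) ^ ((d + 1) / 2) * (k : ℝ) ^ (d / 2) + (n : ℝ) * Real.log n)) →
        R.QueryTimeLE (C * Real.log n) →
        ∀ (lift : ℝ × ℝ → Fin d → ℝ) (score : (Fin 5 → ℝ) → ℝ) (D : Fin n → ℝ × ℝ),
          (((quadraticSweep R lift score scoreCost k).eval D).queries : ℝ) ≤ c₂ * (n : ℝ) ^ d ∧
          ((quadraticSweep R lift score scoreCost k).time D : ℝ) ≤
            c₂ * ((n : ℝ) ^ d * Real.log n) ∧
          (InGeneralPosition (fun i => lift (D i)) →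
            c₁ * ((n : ℝ) ^ d * Real.log n) ≤
              ((quadraticSweep R lift score scoreCost k).time D : ℝ)) := by
  set κ : ℝ := 1 / (2 ^ d * d.factorial) with hκ
  have hκ0 : 0 < κ := by positivity
  have hlog4 : 0 < Real.log 4 := Real.log_pos (by norm_num)
  set a : ℝ := 2 ^ d * (10 * d + scoreCost + 2) with ha
  have ha0 : 0 ≤ a := by positivity
  -- The three thresholds on `log n`: `1` absorbs constant terms, the second gives `log (κ / 2 * n)
  -- ≥ log n / 2`, the third gives `n.choose d ≥ 2`.
  obtain ⟨N, hN⟩ := Filter.eventually_atTop.1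
    ((Real.tendsto_log_atTop.comp tendsto_natCast_atTop_atTop).eventually_ge_atTop
      (max 1 (max (-2 * Real.log (κ / 2)) (Real.log (2 / κ)))))
  -- In `c₁`, the factor 4 comes from halving both `M` and `log n`. In `c₂`, the summands pay for
  -- lifting and output, preprocessing, iterations, and the query count; `|C|` appears because `C`
  -- may be negative.
  refine ⟨κ / (4 * Real.log 4), (d + 6) + 2 * |C| + (d ^ 3 + 2 * (|C| + a)) + 2, by positivity,
    by positivity, max N (max 1 (2 * d)), fun n hn k _ hkn R hR hpre hquery lift score D => ?_⟩
  simp only [max_le_iff] at hn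
  obtain ⟨hnN, hn1, hnd⟩ := hn
  have hNn := hN n hnN
  simp only [Function.comp_apply, max_le_iff] at hNn
  obtain ⟨hlog, hlogκ, hlogκ'⟩ := hNn
  have hn' : (1 : ℝ) ≤ n := by exact_mod_cast hn1
  have hnpow : (n : ℝ) ≤ n ^ d := le_self_pow₀ hn' (by omega)
  have hchoose : (n.choose d : ℝ) ≤ n ^ d := by exact_mod_cast Nat.choose_le_pow n d
  have hlow : κ * n ^ d ≤ n.choose d := mul_pow_le_choose hnd
  refine ⟨?_, ?_, fun hgen => ?_⟩
  · rw [queries_quadraticSweep]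
    push_cast
    have : (0 : ℝ) ≤ ((d + 6) + 2 * |C| + (d ^ 3 + 2 * (|C| + a))) * n ^ d := by positivity
    linarith
  · have hX : (n : ℝ) ^ d ≤ n ^ d * Real.log n := le_mul_of_one_le_right (by positivity) hlog
    have h₁ : (n : ℝ) * (d + 6) ≤ (d + 6) * (n ^ d * Real.log n) := by
      rw [mul_comm]
      gcongr
      exact hnpow.trans hX
    have h₂ : (R.time (fun i => lift (D i)) : ℝ) ≤ 2 * |C| * (n ^ d * Real.log n) := by
      refine (hpre _).trans ?_
      calc _ ≤ |C| * ((n : ℝ) ^ ((d + 1) / 2) * (k : ℝ) ^ (d / 2) + (n : ℝ) * Real.log n) := by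
            gcongr
            exact le_abs_self C
        _ ≤ |C| * (2 * ((n : ℝ) ^ d * Real.log n)) := by
            gcongr
            exact pow_mul_pow_add_mul_log_le hd hn1 hlog hkn
        _ = _ := by ring
    have h₃ : (n.choose d : ℝ) * (d ^ 3 + 2 * (C * Real.log n + a)) ≤
        (d ^ 3 + 2 * (|C| + a)) * (n ^ d * Real.log n) := by
      have hC : C * Real.log n ≤ |C| * Real.log n := by
        gcongr
        exact le_abs_self C
      have hd3 : (d : ℝ) ^ 3 ≤ d ^ 3 * Real.log n := le_mul_of_one_le_right (by positivity) hlog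
      have hal : a ≤ a * Real.log n := le_mul_of_one_le_right ha0 hlog
      calc (n.choose d : ℝ) * (d ^ 3 + 2 * (C * Real.log n + a))
          ≤ n.choose d * ((d ^ 3 + 2 * (|C| + a)) * Real.log n) := by
            gcongr
            linarith
        _ ≤ n ^ d * ((d ^ 3 + 2 * (|C| + a)) * Real.log n) := by gcongr
        _ = _ := by ring
    have h := time_quadraticSweep_le R lift score scoreCost k D hquery
    rw [← ha] at h
    have : (0 : ℝ) ≤ 2 * (n ^ d * Real.log n) := by positivity
    linarith
  · have hpos : (0 : ℝ) < n := by linarith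
    have h2κ : 2 / κ ≤ n := (Real.log_le_log_iff (by positivity) hpos).1 hlogκ'
    have hM : 2 ≤ n.choose d := by
      have : (2 : ℝ) ≤ n.choose d := by
        rw [div_le_iff₀ hκ0] at h2κ
        nlinarith
      exact_mod_cast this
    have hhalf : κ / 2 * n ^ d ≤ n.choose d / 2 := by linarith
    have hlogM : Real.log n / 2 ≤ Real.log (n.choose d / 2) := by
      -- Inside the logarithm `n ^ d` may be weakened to `n`, at the cost of a constant factor only.
      have h₁ : Real.log (κ / 2 * n) ≤ Real.log (n.choose d / 2) := by
        refine Real.log_le_log (by positivity) (le_trans ?_ hhalf)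
        gcongr
      rw [Real.log_mul (by positivity) hpos.ne'] at h₁
      linarith
    calc κ / (4 * Real.log 4) * ((n : ℝ) ^ d * Real.log n)
        = κ / 2 * n ^ d * (Real.log n / 2 / Real.log 4) := by field_simp; ring
      _ ≤ n.choose d / 2 * (Real.log (n.choose d / 2) / Real.log 4) := by gcongr
      _ ≤ _ := half_choose_mul_log_le_sum_sideQueryTime hgen (fun w b => hR _ w b) hM
      _ ≤ _ := by
        exact_mod_cast sum_sideQueryTime_le_time_quadraticSweep R lift score scoreCost k D
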